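/- Write $\vec\sigma=(\sigma_x,\sigma_y,\sigma_z)$ for the Pauli matrices. A qubit POVM is a finite tuple $\mathbf A=(A_1,\dots,A_n)$ of positive semidefinite complex $2\times 2$ matrices with $\sum_i A_i=\mathbb I$. The antipodal operator of a Hermitian $A=a\mathbb I+\vec u\cdot\vec\sigma$ ($a\in\mathbb R$, $\vec u\in\mathbb R^3$) is $\bar A=a\mathbb I-\vec u\cdot\vec\sigma$, and $\bar{\mathbf A}=(\bar A_1,\dots,\bar A_n)$. A pair $\{\mathbf A,\mathbf B\}$ of POVMs is jointly measurable if there is a POVM $(M_{ab})_{a,b}$ with $\sum_b M_{ab}=A_a$ and $\sum_a M_{ab}=B_b$ for all $a,b$. Let $\Phi_t(A)=tA+(1-t)\operatorname{Tr}(A)\,\mathbb I/2$, applied to a POVM effect by effect. The critical visibility of the pair $\{\mathbf A,\mathbf B\}$ (its white noise robustness with respect to joint measurability) is $$t^{\{\mathbf A,\mathbf B\}}=\max\{t\in[0,1] : \{\Phi_t(\mathbf A),\Phi_t(\mathbf B)\}\text{ is jointly measurable}\};$$ the smaller it is, the more robust to noise is the incompatibility of the pair. Corollary 1. Let the unit vectors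 $\vec v_1,\dots,\vec v_4\in\mathbb R^3$ be the vertices of a regular tetrahedron, and let $M^{\mathrm{tetra}}_i=(\mathbb I+\vec v_i\cdot\vec\sigma)/4$. Then $\mathbf M^{\mathrm{tetra}}$ and $\bar{\mathbf M}^{\mathrm{tetra}}$ are POVMs, and the critical visibility of the pair $\{\mathbf M^{\mathrm{tetra}},\bar{\mathbf M}^{\mathrm{tetra}}\}$ exists and equals $\sqrt{2/3}$. This pair is the most robust pair of antipodal qubit measurements regarding joint measurability: for every qubit POVM $\mathbf A$, with any number of outcomes, $\bar{\mathbf A}$ is a POVM, the critical visibility of the pair $\{\mathbf A,\bar{\mathbf A}\}$ exists, and $$t^{\{\mathbf A,\bar{\mathbf A}\}}\ \ge\ \sqrt{2/3}\ =\ t^{\{\mathbf M^{\mathrm{tetra}},\bar{\mathbf M}^{\mathrm{tetra}}\}}.$$ -/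

import Mathlib

open scoped Matrix ComplexOrder

noncomputable section

/-- A finite tuple `A = (A₁, …, Aₙ)` of operators on the Hilbert space with orthonormal basis
indexed by `d` is a POVM (quantum measurement): every effect is positive semidefinite, and the
effects sum to the identity. Null effects are allowed. -/
structure IsPOVM {d X : Type*} [Fintype d] [DecidableEq d] [Fintype X]
    (A : X → Matrix d d ℂ) : Prop where
  posSemidef : ∀ i, (A i).PosSemidef
  sum_eq_one : ∑ i, A i = 1

/-- `M` is a joint measurement of the pair `{A, B}`: a POVM with outcomes `(a, b)` whose
marginals are `A` and `B`. -/
structure IsJointMeasurement {d X Y : Type*} [Fintype d] [DecidableEq d] [Fintype X] [Fintype Y]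
    (M : X × Y → Matrix d d ℂ) (A : X → Matrix d d ℂ) (B : Y → Matrix d d ℂ) : Prop where
  isPOVM : IsPOVM M
  marginal_left : ∀ a, ∑ b, M (a, b) = A a
  marginal_right : ∀ b, ∑ a, M (a, b) = B b

/-- The pair `{A, B}` is jointly measurable. -/
def JointlyMeasurable {d X Y : Type*} [Fintype d] [DecidableEq d] [Fintype X] [Fintype Y]
    (A : X → Matrix d d ℂ) (B : Y → Matrix d d ℂ) : Prop :=
  ∃ M : X × Y → Matrix d d ℂ, IsJointMeasurement M A B

/-- The depolarising map `Φ_t : A ↦ t A + (1 - t) Tr(A) 𝕀 / d`. -/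
def depolarise {d : Type*} [Fintype d] [DecidableEq d] (t : ℝ) (A : Matrix d d ℂ) :
    Matrix d d ℂ :=
  (t : ℂ) • A + ((1 - (t : ℂ)) * A.trace / (Fintype.card d : ℂ)) • (1 : Matrix d d ℂ)

/-- `t` is the critical visibility (white noise robustness) of the pair `{A, B}` for joint
measurability: the largest visibility in `[0, 1]` for which the depolarised pair is jointly
measurable. -/
def IsCriticalVisibility {d X Y : Type*} [Fintype d] [DecidableEq d] [Fintype X] [Fintype Y]
    (A : X → Matrix d d ℂ) (B : Y → Matrix d d ℂ) (t : ℝ) : Prop :=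
  IsGreatest {s : ℝ | s ∈ Set.Icc (0 : ℝ) 1 ∧
    JointlyMeasurable (fun i => depolarise s (A i)) (fun i => depolarise s (B i))} t

/-- The Pauli matrices `σ_x, σ_y, σ_z`. -/
def pauli : Fin 3 → Matrix (Fin 2) (Fin 2) ℂ :=
  ![!![0, 1; 1, 0], !![0, -Complex.I; Complex.I, 0], !![1, 0; 0, -1]]

/-- The qubit operator `a 𝕀 + u · σ`. -/
def blochOperator (a : ℝ) (u : EuclideanSpace ℝ (Fin 3)) : Matrix (Fin 2) (Fin 2) ℂ :=
  (a : ℂ) • (1 : Matrix (Fin 2) (Fin 2) ℂ) + ∑ k, (u k : ℂ) • pauli k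

/-- The coefficient `a` of a Hermitian qubit operator `a 𝕀 + u · σ`. -/
def blochScalar (A : Matrix (Fin 2) (Fin 2) ℂ) : ℝ := A.trace.re / 2

/-- The vector `u` of a Hermitian qubit operator `a 𝕀 + u · σ`. -/
def blochVector (A : Matrix (Fin 2) (Fin 2) ℂ) : EuclideanSpace ℝ (Fin 3) :=
  WithLp.toLp 2 fun k => (A * pauli k).trace.re / 2

/-- The antipodal operator `a 𝕀 - u · σ` of a Hermitian qubit operator `a 𝕀 + u · σ`. -/
def antipodal (A : Matrix (Fin 2) (Fin 2) ℂ) : Matrix (Fin 2) (Fin 2) ℂ :=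
  blochOperator (blochScalar A) (-blochVector A)

/-- Every Hermitian qubit operator is `a 𝕀 + u · σ` with the coefficients above. -/
theorem blochOperator_blochVector {A : Matrix (Fin 2) (Fin 2) ℂ} (hA : A.IsHermitian) :
    blochOperator (blochScalar A) (blochVector A) = A := by
  have h00 := congrArg Complex.im (hA.apply 0 0)
  have h11 := congrArg Complex.im (hA.apply 1 1)
  have h01r := congrArg Complex.re (hA.apply 0 1)
  have h01i := congrArg Complex.im (hA.apply 0 1)
  simp at h00 h11 h01r h01i
  ext i j
  fin_cases i <;> fin_cases j <;> apply Complex.ext <;>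
    simp [blochOperator, blochScalar, blochVector, pauli, Fin.sum_univ_three, Matrix.trace,
      Matrix.mul_apply, Fin.sum_univ_two] <;> linarith

/-- The antipodal operator of `a 𝕀 + u · σ` is `a 𝕀 - u · σ`. -/
theorem antipodal_blochOperator (a : ℝ) (u : EuclideanSpace ℝ (Fin 3)) :
    antipodal (blochOperator a u) = blochOperator a (-u) := by
  ext i j
  fin_cases i <;> fin_cases j <;> apply Complex.ext <;>
    simp [antipodal, blochOperator, blochScalar, blochVector, pauli, Fin.sum_univ_three,
      Matrix.trace, Matrix.mul_apply, Fin.sum_univ_two] <;> ring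

/-- The unit vectors `v₁, …, v₄` in `ℝ³` are the vertices of a regular tetrahedron: all six edges
have the same positive length. -/
structure IsUnitRegularTetrahedron (v : Fin 4 → EuclideanSpace ℝ (Fin 3)) : Prop where
  norm_eq_one : ∀ i, ‖v i‖ = 1
  edges_eq : ∃ l : ℝ, 0 < l ∧ ∀ i j, i ≠ j → dist (v i) (v j) = l

/-- The tetrahedral qubit measurement with effects `(𝕀 + vᵢ · σ) / 4`. -/
def tetraPOVM (v : Fin 4 → EuclideanSpace ℝ (Fin 3)) (i : Fin 4) : Matrix (Fin 2) (Fin 2) ℂ :=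
  (1 / 4 : ℂ) • blochOperator 1 (v i)

end

/-! In Bloch coordinates a joint measurement of the noisy pair is a family of weights `m z` and
vectors `W z` with `‖W z‖ ≤ m z` and prescribed marginals. The pair is symmetric under exchanging
the two outcomes and passing to antipodes, so a single marginal, symmetrised in `m` and
antisymmetrised in `W`, carries all the constraints.

Lower bound: the attainable marginals form a compact convex set. If visibility `√(2/3)` were not
attainable for some POVM, a separating functional would give centres `x i` and radii `p i` with `‖x
i - x j‖ ≤ p i + p j`, that is, pairwise intersecting balls in three-dimensional space. By
`exists_common_point`, inflating the radii by `√(3/2)` produces a common point `y`. Since the Bloch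
vectors sum to zero, the centres may be translated by `y`, and Cauchy–Schwarz then contradicts the
separation (`mem_image_antipodalMarginal`).

The factor `√(3/2)` comes from Helly's theorem, which reduces to four balls, followed by a minimax
argument: the common point is the barycentre for optimal weights, and the optimal value is
controlled by `weighted_variance_le`.

Optimality: for the tetrahedron, pairing `W (i, j)` with the edge `v i - v j` bounds the visibility
by half the edge length, which is `√(2/3)`. -/

/-! ### Inflating pairwise intersecting balls to a common point -/

section PairwiseIntersectingBalls

variable {E : Type*} [NormedAddCommGroup E] [InnerProductSpace ℝ E]

/-- For at most four pairwise intersecting balls, the weighted variance of the centres is at most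
`3 / 2` times the weighted mean of the squared radii. -/
theorem weighted_variance_le {ι : Type*} [Fintype ι] (hι : Fintype.card ι ≤ 4)
    (x : ι → E) (p : ι → ℝ) (hp : ∀ a, 0 ≤ p a) (hx : ∀ a b, ‖x a - x b‖ ≤ p a + p b)
    (l : ι → ℝ) (hl : l ∈ stdSimplex ℝ ι) :
    ∑ a, l a * (‖x a‖ ^ 2 - 3 / 2 * p a ^ 2) - ‖∑ a, l a • x a‖ ^ 2 ≤ 0 := by
  classical
  obtain ⟨hl0, hl1⟩ := hl
  -- The left side vanishes on the diagonal, so the diagonal of the right side is removed; without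
  -- this saving the constant would be 2 instead of 3/2.
  have hpair : ∀ a b, l a * l b * ‖x a - x b‖ ^ 2 ≤
      l a * l b * (p a + p b) ^ 2 - (if a = b then 4 * (l a * p a) ^ 2 else 0) := by
    intro a b
    by_cases hab : a = b
    · subst hab
      simp only [sub_self, norm_zero, if_true]
      nlinarith
    · simp only [if_neg hab, sub_zero]
      exact mul_le_mul_of_nonneg_left (pow_le_pow_left₀ (norm_nonneg _) (hx a b) 2)
        (mul_nonneg (hl0 a) (hl0 b))
  have hsum := Finset.sum_le_sum fun a (_ : a ∈ Finset.univ) =>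
    Finset.sum_le_sum fun b (_ : b ∈ Finset.univ) => hpair a b
  have hnorm : ‖∑ a, l a • x a‖ ^ 2 = ∑ a, ∑ b, l a * l b * inner ℝ (x a) (x b) := by
    rw [← real_inner_self_eq_norm_sq, sum_inner]
    refine Finset.sum_congr rfl fun a _ => ?_
    rw [inner_sum]
    refine Finset.sum_congr rfl fun b _ => ?_
    rw [real_inner_smul_left, real_inner_smul_right]
    ring
  have hL : ∑ a, ∑ b, l a * l b * ‖x a - x b‖ ^ 2 =
      2 * ∑ a, l a * ‖x a‖ ^ 2 - 2 * ‖∑ a, l a • x a‖ ^ 2 := by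
    have : ∀ a b, l a * l b * ‖x a - x b‖ ^ 2 = (l a * ‖x a‖ ^ 2) * l b + l a * (l b * ‖x b‖ ^ 2)
        - 2 * (l a * l b * inner ℝ (x a) (x b)) := by
      intro a b
      rw [norm_sub_sq_real]
      ring
    simp only [this, Finset.sum_sub_distrib, Finset.sum_add_distrib, ← Finset.mul_sum, hl1,
      hnorm]
    simp only [← Finset.sum_mul, hl1]
    ring
  have hR : ∑ a, ∑ b, (l a * l b * (p a + p b) ^ 2 - (if a = b then 4 * (l a * p a) ^ 2 else 0)) =
      2 * ∑ a, l a * p a ^ 2 + 2 * (∑ a, l a * p a) ^ 2 - 4 * ∑ a, (l a * p a) ^ 2 := by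
    have : ∀ a b, l a * l b * (p a + p b) ^ 2 = (l a * p a ^ 2) * l b + l a * (l b * p b ^ 2)
        + 2 * ((l a * p a) * (l b * p b)) := by
      intro a b
      ring
    simp only [this, Finset.sum_sub_distrib, Finset.sum_add_distrib, Finset.sum_ite_eq,
      Finset.mem_univ, if_true]
    simp only [← Finset.mul_sum, ← Finset.sum_mul, hl1]
    ring
  -- The only use of having at most four balls: the removed diagonal is worth at least `(∑ l p)²`,
  -- leaving `2 ∑ l p² + (∑ l p)² ≤ 3 ∑ l p²` as a bound for twice the variance.
  have hcs : (∑ a, l a * p a) ^ 2 ≤ 4 * ∑ a, (l a * p a) ^ 2 := by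
    refine (sq_sum_le_card_mul_sum_sq (s := Finset.univ) (f := fun a => l a * p a)).trans ?_
    refine mul_le_mul_of_nonneg_right ?_ (Finset.sum_nonneg fun a _ => sq_nonneg _)
    exact_mod_cast hι
  have hjensen : (∑ a, l a * p a) ^ 2 ≤ ∑ a, l a * p a ^ 2 :=
    (convexOn_pow 2).map_sum_le (fun a _ => hl0 a) hl1 fun a _ => hp a
  have hG : ∑ a, l a * (‖x a‖ ^ 2 - 3 / 2 * p a ^ 2) =
      ∑ a, l a * ‖x a‖ ^ 2 - 3 / 2 * ∑ a, l a * p a ^ 2 := by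
    rw [Finset.mul_sum, ← Finset.sum_sub_distrib]
    exact Finset.sum_congr rfl fun a _ => by ring
  rw [hL, hR] at hsum
  linarith

/-- Four pairwise intersecting balls have a common point after inflation by `√(3 / 2)`. -/
theorem exists_common_point_of_card_le_four {ι : Type*} [Fintype ι] (hι : Fintype.card ι ≤ 4)
    (x : ι → E) (p : ι → ℝ) (hp : ∀ a, 0 ≤ p a) (hx : ∀ a b, ‖x a - x b‖ ≤ p a + p b) :
    ∃ y, ∀ a, ‖x a - y‖ ^ 2 ≤ 3 / 2 * p a ^ 2 := by
  classical
  rcases isEmpty_or_nonempty ι with _ | _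
  · exact ⟨0, fun a => isEmptyElim a⟩
  obtain ⟨l, hl, hmax⟩ := (isCompact_stdSimplex ℝ ι).exists_isMaxOn
    ⟨_, single_mem_stdSimplex ℝ (Classical.arbitrary ι)⟩
    (f := fun l : ι → ℝ =>
      ∑ a, l a * (‖x a‖ ^ 2 - 3 / 2 * p a ^ 2) - ‖∑ a, l a • x a‖ ^ 2)
    (by fun_prop)
  have hle := weighted_variance_le hι x p hp hx l hl
  set c : ι → ℝ := fun a => ‖x a‖ ^ 2 - 3 / 2 * p a ^ 2 with hc
  set y := ∑ a, l a • x a with hy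
  refine ⟨y, fun a => ?_⟩
  set d := ‖x a - y‖ ^ 2 - 3 / 2 * p a ^ 2 - (∑ b, l b * c b - ‖y‖ ^ 2) with hd
  suffices d ≤ 0 by linarith
  -- First-order optimality at `l`: moving a fraction `s` of the weight to the vertex `a` changes
  -- the objective by `s * d - s² * ‖x a - y‖²`, which cannot be positive.
  have key : ∀ s : ℝ, 0 < s → s ≤ 1 → d ≤ s * ‖x a - y‖ ^ 2 := by
    intro s hs0 hs1
    obtain ⟨l', hl'⟩ : ∃ l' : ι → ℝ, l' = (1 - s) • l + s • Pi.single a 1 := ⟨_, rfl⟩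
    have hmem : l' ∈ stdSimplex ℝ ι := hl' ▸ convex_stdSimplex ℝ ι hl (single_mem_stdSimplex ℝ a)
      (sub_nonneg.2 hs1) hs0.le (by ring : 1 - s + s = 1)
    have hl'b : ∀ b, l' b = (1 - s) * l b + if b = a then s else 0 := by
      intro b
      simp [hl', Pi.single_apply]
    have h : ∑ b, l' b * c b - ‖∑ b, l' b • x b‖ ^ 2 ≤ ∑ b, l b * c b - ‖y‖ ^ 2 := hmax hmem
    have e1 : ∑ b, l' b * c b = (1 - s) * ∑ b, l b * c b + s * c a := by
      simp [hl'b, add_mul, Finset.sum_add_distrib, Finset.mul_sum, mul_assoc]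
    have e2 : ∑ b, l' b • x b = y + s • (x a - y) := by
      have : ∑ b, l' b • x b = (1 - s) • y + s • x a := by
        simp [hl'b, add_smul, Finset.sum_add_distrib, Finset.smul_sum, mul_smul, hy]
      rw [this]
      module
    have e3 : ‖y + s • (x a - y)‖ ^ 2 =
        ‖y‖ ^ 2 + s * (‖x a‖ ^ 2 - ‖y‖ ^ 2 - ‖x a - y‖ ^ 2) + s ^ 2 * ‖x a - y‖ ^ 2 := by
      rw [norm_add_sq_real, norm_smul, real_inner_smul_right, norm_sub_sq_real, inner_sub_right,
        real_inner_self_eq_norm_sq, real_inner_comm, mul_pow, norm_sub_sq_real, Real.norm_eq_abs,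
        sq_abs]
      ring
    rw [e1, e2, e3] at h
    have hsd : s * d ≤ s * (s * ‖x a - y‖ ^ 2) := by
      rw [hd]
      simp only [hc] at h ⊢
      linarith
    exact le_of_mul_le_mul_left hsd hs0
  by_contra! hdpos
  have h1 := key 1 one_pos le_rfl
  rw [one_mul] at h1
  have hN : 0 < ‖x a - y‖ ^ 2 := hdpos.trans_le h1
  -- This replaces the limit `s → 0`: the chosen `s` gives `d ≤ d / 2`. The case `s = 1` ensured
  -- that it is at most 1.
  have h2 := key (d / (2 * ‖x a - y‖ ^ 2)) (by positivity) (by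
    rw [div_le_one (by positivity)]
    linarith)
  have : d / (2 * ‖x a - y‖ ^ 2) * ‖x a - y‖ ^ 2 = d / 2 := by
    generalize ‖x a - y‖ ^ 2 = N at hN
    field_simp
  linarith

/-- Pairwise intersecting balls in a three-dimensional Euclidean space have a common point after
inflation by `√(3 / 2)`. -/
theorem exists_common_point (hE : Module.finrank ℝ E = 3) {ι : Type*} [Fintype ι]
    (x : ι → E) (p : ι → ℝ) (hx : ∀ a b, ‖x a - x b‖ ≤ p a + p b) :
    ∃ y, ∀ a, ‖x a - y‖ ≤ √(3 / 2) * p a := by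
  classical
  have : FiniteDimensional ℝ E := Module.finite_of_finrank_pos (by omega)
  have hp : ∀ a, 0 ≤ p a := fun a => by
    have := hx a a
    simp only [sub_self, norm_zero] at this
    linarith
  -- In dimension three, Helly's theorem only asks about subfamilies of at most 3 + 1 balls.
  have := Convex.helly_theorem' (𝕜 := ℝ) (F := fun a => Metric.closedBall (x a) (√(3 / 2) * p a))
    (s := Finset.univ) (fun a _ => convex_closedBall _ _) (by
      intro I _ hI
      rw [hE] at hI
      obtain ⟨y, hy⟩ := exists_common_point_of_card_le_four (ι := I) (by simpa using hI)
        (fun a => x a) (fun a => p a) (fun a => hp a) (fun a b => hx a b)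
      refine ⟨y, ?_⟩
      simp only [Set.mem_iInter]
      intro a ha
      rw [mem_closedBall_iff_norm']
      refine abs_le_of_sq_le_sq' ?_ (mul_nonneg (Real.sqrt_nonneg _) (hp a)) |>.2
      rw [mul_pow, Real.sq_sqrt (by norm_num)]
      exact hy ⟨a, ha⟩)
  obtain ⟨y, hy⟩ := this
  simp only [Set.mem_iInter, Finset.mem_univ, true_imp_iff] at hy
  exact ⟨y, fun a => mem_closedBall_iff_norm'.1 (hy a)⟩

end PairwiseIntersectingBalls

/-! ### Positivity and joint measurability in Bloch coordinates -/

section Bloch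

theorem isHermitian_blochOperator (a : ℝ) (u : EuclideanSpace ℝ (Fin 3)) :
    (blochOperator a u).IsHermitian := by
  ext i j
  fin_cases i <;> fin_cases j <;> apply Complex.ext <;>
    simp [blochOperator, pauli, Fin.sum_univ_three]

theorem blochScalar_blochOperator (a : ℝ) (u : EuclideanSpace ℝ (Fin 3)) :
    blochScalar (blochOperator a u) = a := by
  simp [blochOperator, blochScalar, pauli, Fin.sum_univ_three, Matrix.trace, Fin.sum_univ_two]
  ring

theorem blochVector_blochOperator (a : ℝ) (u : EuclideanSpace ℝ (Fin 3)) :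
    blochVector (blochOperator a u) = u := by
  ext k
  fin_cases k <;>
    simp [blochOperator, blochVector, pauli, Fin.sum_univ_three, Matrix.trace, Matrix.mul_apply,
      Fin.sum_univ_two]
  all_goals ring

theorem blochOperator_inj {a b : ℝ} {u w : EuclideanSpace ℝ (Fin 3)} :
    blochOperator a u = blochOperator b w ↔ a = b ∧ u = w := by
  refine ⟨fun h => ⟨?_, ?_⟩, fun h => by rw [h.1, h.2]⟩
  · rw [← blochScalar_blochOperator a u, h, blochScalar_blochOperator]
  · rw [← blochVector_blochOperator a u, h, blochVector_blochOperator]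

theorem sum_blochOperator {ι : Type*} (s : Finset ι) (a : ι → ℝ)
    (u : ι → EuclideanSpace ℝ (Fin 3)) :
    ∑ i ∈ s, blochOperator (a i) (u i) = blochOperator (∑ i ∈ s, a i) (∑ i ∈ s, u i) := by
  simp only [blochOperator, Finset.sum_add_distrib, ← Finset.sum_smul, Complex.ofReal_sum,
    WithLp.ofLp_sum, Finset.sum_apply]
  rw [Finset.sum_comm]
  simp only [← Finset.sum_smul]

theorem blochOperator_one_zero : blochOperator 1 0 = 1 := by
  simp [blochOperator]

theorem depolarise_blochOperator (t a : ℝ) (u : EuclideanSpace ℝ (Fin 3)) :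
    depolarise t (blochOperator a u) = blochOperator a (t • u) := by
  ext i j
  fin_cases i <;> fin_cases j <;> apply Complex.ext <;>
    simp [depolarise, blochOperator, pauli, Fin.sum_univ_three, Matrix.trace,
      Fin.sum_univ_two] <;> ring

theorem det_blochOperator (a : ℝ) (u : EuclideanSpace ℝ (Fin 3)) :
    (blochOperator a u).det = ((a ^ 2 - ‖u‖ ^ 2 : ℝ) : ℂ) := by
  rw [EuclideanSpace.real_norm_sq_eq, Fin.sum_univ_three]
  apply Complex.ext <;>
    simp [blochOperator, pauli, Fin.sum_univ_three, Matrix.det_fin_two, pow_two] <;> ring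

/-- Cayley–Hamilton for trace `2a` and determinant `a² - ‖u‖²`. When `‖u‖ ≤ a` the right side is
visibly positive semidefinite, so no eigenvalues are needed. -/
theorem two_mul_smul_blochOperator (a : ℝ) (u : EuclideanSpace ℝ (Fin 3)) :
    (2 * a) • blochOperator a u = (blochOperator a u)ᴴ * blochOperator a u +
      (a ^ 2 - ‖u‖ ^ 2) • (1 : Matrix (Fin 2) (Fin 2) ℂ) := by
  rw [(isHermitian_blochOperator a u).eq, EuclideanSpace.real_norm_sq_eq, Fin.sum_univ_three]
  simp only [pow_two]
  ext i j
  fin_cases i <;> fin_cases j <;> apply Complex.ext <;>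
    simp [blochOperator, pauli, Fin.sum_univ_three, Matrix.mul_apply,
      Fin.sum_univ_two] <;> ring

theorem posSemidef_blochOperator_iff {a : ℝ} {u : EuclideanSpace ℝ (Fin 3)} :
    (blochOperator a u).PosSemidef ↔ ‖u‖ ≤ a := by
  constructor
  · intro h
    have h1 := h.det_nonneg
    rw [det_blochOperator, Complex.zero_le_real] at h1
    have h2 : 0 ≤ blochScalar (blochOperator a u) :=
      div_nonneg (Complex.nonneg_iff.1 h.trace_nonneg).1 two_pos.le
    rw [blochScalar_blochOperator] at h2
    exact abs_le_of_sq_le_sq' (by linarith) h2 |>.2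
  · intro h
    rcases ((norm_nonneg u).trans h).eq_or_lt with ha | ha
    · subst ha
      have hu : u = 0 := norm_le_zero_iff.1 h
      subst hu
      have : blochOperator 0 0 = 0 := by simp [blochOperator]
      rw [this]
      exact Matrix.PosSemidef.zero
    · have hsq : 0 ≤ a ^ 2 - ‖u‖ ^ 2 :=
        sub_nonneg.2 (pow_le_pow_left₀ (norm_nonneg u) h 2)
      have hpos : ((2 * a) • blochOperator a u).PosSemidef := by
        rw [two_mul_smul_blochOperator]
        exact (Matrix.posSemidef_conjTranspose_mul_self _).add (Matrix.PosSemidef.one.smul hsq)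
      have := hpos.smul (inv_nonneg.2 (by positivity : 0 ≤ 2 * a))
      rwa [smul_smul, inv_mul_cancel₀ (by positivity), one_smul] at this

theorem isPOVM_blochOperator_iff {X : Type*} [Fintype X] {a : X → ℝ}
    {u : X → EuclideanSpace ℝ (Fin 3)} :
    IsPOVM (fun i => blochOperator (a i) (u i)) ↔
      (∀ i, ‖u i‖ ≤ a i) ∧ ∑ i, a i = 1 ∧ ∑ i, u i = 0 := by
  constructor
  · rintro ⟨h1, h2⟩
    rw [sum_blochOperator, ← blochOperator_one_zero, blochOperator_inj] at h2
    exact ⟨fun i => posSemidef_blochOperator_iff.1 (h1 i), h2⟩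
  · rintro ⟨h1, h2, h3⟩
    exact ⟨fun i => posSemidef_blochOperator_iff.2 (h1 i), by
      rw [sum_blochOperator, h2, h3, blochOperator_one_zero]⟩

/-- Bloch coordinates of a POVM, up to the condition that the Bloch vectors sum to zero. -/
def blochPOVMSet (Z : Type*) [Fintype Z] : Set ((Z → ℝ) × (Z → EuclideanSpace ℝ (Fin 3))) :=
  {q | (∀ z, ‖q.2 z‖ ≤ q.1 z) ∧ ∑ z, q.1 z = 1}

theorem isCompact_blochPOVMSet (Z : Type*) [Fintype Z] : IsCompact (blochPOVMSet Z) := by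
  refine ((isCompact_univ_pi fun _ : Z => isCompact_Icc (a := (0 : ℝ)) (b := 1)).prod
    (isCompact_univ_pi fun _ : Z =>
      isCompact_closedBall (0 : EuclideanSpace ℝ (Fin 3)) 1)).of_isClosed_subset ?_ ?_
  · have : blochPOVMSet Z = (⋂ z, {q | ‖q.2 z‖ ≤ q.1 z}) ∩ {q | ∑ z, q.1 z = 1} := by
      ext q
      simp [blochPOVMSet]
    rw [this]
    exact (isClosed_iInter fun z => isClosed_le (by fun_prop) (by fun_prop)).inter
      (isClosed_eq (by fun_prop) continuous_const)
  · rintro ⟨m, W⟩ ⟨h1, h2⟩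
    have h0 : ∀ z, 0 ≤ m z := fun z => (norm_nonneg _).trans (h1 z)
    have hm : ∀ z, m z ≤ 1 := fun z => h2 ▸
      Finset.single_le_sum (f := m) (fun z _ => h0 z) (Finset.mem_univ z)
    refine ⟨fun z _ => ⟨h0 z, hm z⟩, fun z _ => ?_⟩
    rw [mem_closedBall_zero_iff]
    exact (h1 z).trans (hm z)

theorem convex_blochPOVMSet (Z : Type*) [Fintype Z] : Convex ℝ (blochPOVMSet Z) := by
  rintro ⟨m, W⟩ ⟨h1, h2⟩ ⟨m', W'⟩ ⟨h1', h2'⟩ s t hs ht hst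
  refine ⟨fun z => ?_, ?_⟩
  · refine (norm_add_le _ _).trans ?_
    simp only [Pi.smul_apply, Prod.fst_add, Prod.smul_fst, Pi.add_apply, smul_eq_mul,
      Prod.smul_snd, norm_smul, Real.norm_of_nonneg hs, Real.norm_of_nonneg ht]
    exact add_le_add (mul_le_mul_of_nonneg_left (h1 z) hs) (mul_le_mul_of_nonneg_left (h1' z) ht)
  · simp only at h2 h2'
    simp [Finset.sum_add_distrib, ← Finset.mul_sum, h2, h2', hst]

/-- Joint measurability of qubit POVMs in Bloch coordinates. -/
theorem jointlyMeasurable_blochOperator_iff {X Y : Type*} [Fintype X] [Fintype Y]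
    {a : X → ℝ} {u : X → EuclideanSpace ℝ (Fin 3)} {b : Y → ℝ} {w : Y → EuclideanSpace ℝ (Fin 3)}
    (hu : ∑ i, u i = 0) :
    JointlyMeasurable (fun i => blochOperator (a i) (u i)) (fun j => blochOperator (b j) (w j)) ↔
      ∃ q ∈ blochPOVMSet (X × Y), (∀ i, ∑ j, q.1 (i, j) = a i) ∧ (∀ j, ∑ i, q.1 (i, j) = b j) ∧
        (∀ i, ∑ j, q.2 (i, j) = u i) ∧ ∀ j, ∑ i, q.2 (i, j) = w j := by
  constructor
  · rintro ⟨M, hM, hl, hr⟩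
    have hB : ∀ z, blochOperator (blochScalar (M z)) (blochVector (M z)) = M z := fun z =>
      blochOperator_blochVector (hM.posSemidef z).isHermitian
    obtain ⟨h1, h2, -⟩ := isPOVM_blochOperator_iff.1 (by simpa only [hB] using hM :
      IsPOVM fun z => blochOperator (blochScalar (M z)) (blochVector (M z)))
    have hl' := fun i => blochOperator_inj.1 ((sum_blochOperator Finset.univ
      (fun j => blochScalar (M (i, j))) (fun j => blochVector (M (i, j)))).symm.trans
        (by simpa only [hB] using hl i))
    have hr' := fun j => blochOperator_inj.1 ((sum_blochOperator Finset.univ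
      (fun i => blochScalar (M (i, j))) (fun i => blochVector (M (i, j)))).symm.trans
        (by simpa only [hB] using hr j))
    exact ⟨(fun z => blochScalar (M z), fun z => blochVector (M z)), ⟨h1, h2⟩,
      fun i => (hl' i).1, fun j => (hr' j).1, fun i => (hl' i).2, fun j => (hr' j).2⟩
  · rintro ⟨⟨m, W⟩, ⟨h1, h2⟩, ha, hb, hau, hbw⟩
    refine ⟨fun z => blochOperator (m z) (W z), isPOVM_blochOperator_iff.2 ⟨h1, h2, ?_⟩, ?_, ?_⟩
    -- The zero-sum condition absent from `blochPOVMSet` is recovered from the left marginal.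
    · rw [Fintype.sum_prod_type, ← hu]
      exact Finset.sum_congr rfl fun i _ => hau i
    · intro i
      rw [sum_blochOperator]
      exact blochOperator_inj.2 ⟨ha i, hau i⟩
    · intro j
      rw [sum_blochOperator]
      exact blochOperator_inj.2 ⟨hb j, hbw j⟩

end Bloch

/-! ### Lower bound for antipodal pairs by convex duality -/

section Antipodal

variable {X : Type*} [Fintype X]

/-- The symmetrised scalar marginal and antisymmetrised vector marginal of Bloch coordinates on
`X × X`. -/
noncomputable def antipodalMarginal (X : Type*) [Fintype X] :
    ((X × X → ℝ) × (X × X → EuclideanSpace ℝ (Fin 3))) →ₗ[ℝ]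
      (X → ℝ) × (X → EuclideanSpace ℝ (Fin 3)) where
  toFun q := (fun a => ∑ b, (1 / 2 : ℝ) • (q.1 (a, b) + q.1 (b, a)),
    fun a => ∑ b, (1 / 2 : ℝ) • (q.2 (a, b) - q.2 (b, a)))
  map_add' q r := by
    refine Prod.ext (funext fun a => ?_) (funext fun a => ?_)
    · simp only [Prod.fst_add, Pi.add_apply, ← Finset.sum_add_distrib]
      exact Finset.sum_congr rfl fun b _ => by module
    · simp only [Prod.snd_add, Pi.add_apply, ← Finset.sum_add_distrib]
      exact Finset.sum_congr rfl fun b _ => by module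
  map_smul' c q := by
    refine Prod.ext (funext fun a => ?_) (funext fun a => ?_)
    · simp only [Prod.smul_fst, Pi.smul_apply, Finset.smul_sum, RingHom.id_apply]
      exact Finset.sum_congr rfl fun b _ => by module
    · simp only [Prod.smul_snd, Pi.smul_apply, Finset.smul_sum, RingHom.id_apply]
      exact Finset.sum_congr rfl fun b _ => by module

/-- These point masses test the separating functional. With `‖w‖ ≤ 1` they lie in `blochPOVMSet`
precisely because the vectors there need not sum to zero. -/
theorem antipodalMarginal_single [DecidableEq X] (a b : X) (w : EuclideanSpace ℝ (Fin 3)) :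
    antipodalMarginal X (Pi.single (a, b) 1, Pi.single (a, b) w) =
      ((1 / 2 : ℝ) • (Pi.single a 1 + Pi.single b 1),
        (1 / 2 : ℝ) • (Pi.single a w - Pi.single b w)) := by
  have key : ∀ {V : Type} [AddCommGroup V] (w : V) (c : X),
      ∑ d, (Pi.single (a, b) w : X × X → V) (c, d) = (Pi.single a w : X → V) c ∧
      ∑ d, (Pi.single (a, b) w : X × X → V) (d, c) = (Pi.single b w : X → V) c := by
    intro V _ w c
    constructor
    · by_cases h : c = a <;> simp [Pi.single_apply, h]
    · by_cases h : c = b <;> simp [Pi.single_apply, h]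
  refine Prod.ext (funext fun c => ?_) (funext fun c => ?_)
  · change ∑ d, (1 / 2 : ℝ) • _ = _
    rw [← Finset.smul_sum, Finset.sum_add_distrib, (key _ c).1, (key _ c).2]
    rfl
  · change ∑ d, (1 / 2 : ℝ) • _ = _
    rw [← Finset.smul_sum, Finset.sum_sub_distrib, (key _ c).1, (key _ c).2]
    rfl

/-- By duality with the inflation of pairwise intersecting balls, the Bloch coordinates of a qubit
POVM with its vectors shrunk by `√(2 / 3)` are antipodal marginals. -/
theorem mem_image_antipodalMarginal {a : X → ℝ} {u : X → EuclideanSpace ℝ (Fin 3)}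
    (hau : ∀ i, ‖u i‖ ≤ a i) (ha : ∑ i, a i = 1) (hu : ∑ i, u i = 0) :
    (a, √(2 / 3) • u) ∈ antipodalMarginal X '' blochPOVMSet (X × X) := by
  classical
  by_contra hmem
  have hcont : Continuous (antipodalMarginal X) :=
    (antipodalMarginal X).continuous_of_finiteDimensional
  obtain ⟨f, s, hfs, hsf⟩ := geometric_hahn_banach_point_closed
    ((convex_blochPOVMSet (X × X)).linear_image (antipodalMarginal X))
    ((isCompact_blochPOVMSet (X × X)).image hcont).isClosed hmem
  have hx : ∀ i, ∃ x : EuclideanSpace ℝ (Fin 3), ∀ w, f (0, Pi.single i w) = -inner ℝ x w := by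
    intro i
    refine ⟨-(InnerProductSpace.toDual ℝ _).symm ((f.comp (ContinuousLinearMap.inr ℝ _ _)).comp
      (ContinuousLinearMap.single ℝ (fun _ : X => EuclideanSpace ℝ (Fin 3)) i)), fun w => ?_⟩
    rw [inner_neg_left, neg_neg, InnerProductSpace.toDual_symm_apply]
    rfl
  choose x hx using hx
  have hP : ∀ i (c : ℝ), f (Pi.single i c, 0) = c * f (Pi.single i 1, 0) := by
    intro i c
    rw [← smul_eq_mul, ← map_smul]
    congr 1
    ext j <;> simp [Pi.single_apply]
  have hf : ∀ (b : X → ℝ) (w : X → EuclideanSpace ℝ (Fin 3)),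
      f (b, w) = ∑ i, b i * f (Pi.single i 1, 0) - ∑ i, inner ℝ (x i) (w i) := by
    intro b w
    have hb : f (b, 0) = ∑ i, b i * f (Pi.single i 1, 0) := by
      have : (b, (0 : X → EuclideanSpace ℝ (Fin 3))) = ∑ i, (Pi.single i (b i), 0) := by
        refine Prod.ext ?_ ?_
        · rw [Prod.fst_sum, Finset.univ_sum_single]
        · rw [Prod.snd_sum, Finset.sum_const_zero]
      rw [this, map_sum]
      exact Finset.sum_congr rfl fun i _ => hP i _
    have hw : f (0, w) = -∑ i, inner ℝ (x i) (w i) := by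
      have : ((0 : X → ℝ), w) = ∑ i, (0, Pi.single i (w i)) := by
        refine Prod.ext ?_ ?_
        · rw [Prod.fst_sum, Finset.sum_const_zero]
        · rw [Prod.snd_sum, Finset.univ_sum_single]
      rw [this, map_sum, ← Finset.sum_neg_distrib]
      exact Finset.sum_congr rfl fun i _ => hx i _
    rw [sub_eq_add_neg, ← hb, ← hw, ← map_add]
    simp
  -- Absorbing the threshold `s` into the scalar coefficients turns the separation into a statement
  -- about balls with centres `x i` and radii `p i`.
  set p : X → ℝ := fun i => f (Pi.single i 1, 0) - s with hp
  have hballs : ∀ i j, ‖x i - x j‖ ≤ p i + p j := by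
    intro i j
    -- The direction that makes the tested inequality sharpest; if `x i = x j` it is zero, which is
    -- still admissible.
    set w := ‖x i - x j‖⁻¹ • (x i - x j) with hw
    have hw1 : ‖w‖ ≤ 1 := by
      rw [hw, norm_smul, norm_inv, norm_norm]
      exact inv_mul_le_one
    have hinner : inner ℝ (x i - x j) w = ‖x i - x j‖ := by
      rw [hw, real_inner_smul_right, real_inner_self_eq_norm_sq, pow_two, ← mul_assoc]
      exact inv_mul_mul_self _
    have h := hsf _ ⟨(Pi.single (i, j) 1, Pi.single (i, j) w), ⟨fun z => ?_, ?_⟩, rfl⟩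
    · rw [antipodalMarginal_single, ← Prod.smul_mk, map_smul, hf] at h
      simp only [Pi.add_apply, Pi.sub_apply, add_mul, inner_sub_right, Finset.sum_add_distrib,
        Finset.sum_sub_distrib, smul_eq_mul] at h
      have e : ∀ k, ∑ l, inner ℝ (x l) ((Pi.single k w : X → EuclideanSpace ℝ (Fin 3)) l) =
          inner ℝ (x k) w := by
        intro k
        rw [Finset.sum_eq_single k]
        · simp
        · intro l _ hl
          simp [hl]
        · simp
      rw [e, e] at h
      simp only [Pi.single_apply, ite_mul, one_mul, zero_mul, Finset.sum_ite_eq',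
        Finset.mem_univ, if_true] at h
      rw [← hinner, inner_sub_left]
      simp only [hp]
      linarith
    · by_cases hz : z = (i, j)
      · subst hz
        simpa using hw1
      · simp [hz]
    · simp
  obtain ⟨y, hy⟩ := exists_common_point (by simp) x p hballs
  have hbound : ∀ i, √(2 / 3) * inner ℝ (x i - y) (u i) ≤ a i * p i := by
    intro i
    have h1 : inner ℝ (x i - y) (u i) ≤ √(3 / 2) * p i * a i :=
      (real_inner_le_norm _ _).trans
        (mul_le_mul (hy i) (hau i) (norm_nonneg _) ((norm_nonneg _).trans (hy i)))
    have h2 : √(2 / 3) * √(3 / 2) = 1 := by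
      rw [← Real.sqrt_mul (by norm_num)]
      norm_num
    calc √(2 / 3) * inner ℝ (x i - y) (u i) ≤ √(2 / 3) * (√(3 / 2) * p i * a i) :=
          mul_le_mul_of_nonneg_left h1 (Real.sqrt_nonneg _)
      _ = √(2 / 3) * √(3 / 2) * (a i * p i) := by ring
      _ = a i * p i := by rw [h2, one_mul]
  have hsum := Finset.sum_le_sum fun i (_ : i ∈ Finset.univ) => hbound i
  -- The translation by `y` is invisible because the Bloch vectors sum to zero.
  have e1 : ∑ i, √(2 / 3) * inner ℝ (x i - y) (u i) =
      ∑ i, inner ℝ (x i) ((√(2 / 3) • u) i) := by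
    have : ∑ i, inner ℝ y (u i) = 0 := by rw [← inner_sum, hu, inner_zero_right]
    simp only [inner_sub_left, mul_sub, Finset.sum_sub_distrib, ← Finset.mul_sum, this, mul_zero,
      sub_zero, Pi.smul_apply, real_inner_smul_right]
  have e2 : ∑ i, a i * p i = ∑ i, a i * f (Pi.single i 1, 0) - s := by
    simp only [hp, mul_sub, Finset.sum_sub_distrib, ← Finset.sum_mul, ha, one_mul]
  rw [hf] at hfs
  linarith

/-- The Bloch coordinates of a joint measurement of a depolarised qubit POVM and its antipodal
POVM. -/
theorem jointlyMeasurable_depolarise_antipodal_iff {a : X → ℝ} {u : X → EuclideanSpace ℝ (Fin 3)}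
    (hu : ∑ i, u i = 0) (s : ℝ) :
    JointlyMeasurable (fun i => depolarise s (blochOperator (a i) (u i)))
        (fun i => depolarise s (antipodal (blochOperator (a i) (u i)))) ↔
      ∃ q ∈ blochPOVMSet (X × X), (∀ i, ∑ j, q.1 (i, j) = a i) ∧ (∀ j, ∑ i, q.1 (i, j) = a j) ∧
        (∀ i, ∑ j, q.2 (i, j) = s • u i) ∧ ∀ j, ∑ i, q.2 (i, j) = s • -u j := by
  simp only [antipodal_blochOperator, depolarise_blochOperator]
  exact jointlyMeasurable_blochOperator_iff (by rw [← Finset.smul_sum, hu, smul_zero])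

/-- A preimage under `antipodalMarginal` need not itself have the right marginals, but averaging it
with its outcome-swapped antipode does. The average keeps `‖W z‖ ≤ m z` by the triangle inequality.
-/
theorem jointlyMeasurable_depolarise_sqrt {a : X → ℝ} {u : X → EuclideanSpace ℝ (Fin 3)}
    (hau : ∀ i, ‖u i‖ ≤ a i) (ha : ∑ i, a i = 1) (hu : ∑ i, u i = 0) :
    JointlyMeasurable (fun i => depolarise √(2 / 3) (blochOperator (a i) (u i)))
        (fun i => depolarise √(2 / 3) (antipodal (blochOperator (a i) (u i)))) := by
  obtain ⟨⟨m, W⟩, ⟨h1, h2⟩, hq⟩ := mem_image_antipodalMarginal hau ha hu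
  simp only at h1 h2
  rw [jointlyMeasurable_depolarise_antipodal_iff hu]
  have hm : ∀ i, ∑ j, (1 / 2 : ℝ) • (m (i, j) + m (j, i)) = a i := fun i =>
    congrFun (congrArg Prod.fst hq) i
  have hW : ∀ i, ∑ j, (1 / 2 : ℝ) • (W (i, j) - W (j, i)) = √(2 / 3) • u i := fun i =>
    congrFun (congrArg Prod.snd hq) i
  refine ⟨(fun z => (1 / 2 : ℝ) • (m z + m z.swap), fun z => (1 / 2 : ℝ) • (W z - W z.swap)),
    ⟨fun z => ?_, ?_⟩, hm, fun j => ?_, hW, fun j => ?_⟩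
  · simp only [norm_smul, smul_eq_mul, Real.norm_of_nonneg (by norm_num : (0 : ℝ) ≤ 1 / 2)]
    exact mul_le_mul_of_nonneg_left
      ((norm_sub_le _ _).trans (add_le_add (h1 z) (h1 z.swap))) (by norm_num)
  · rw [Fintype.sum_prod_type]
    exact (Finset.sum_congr rfl fun i _ => hm i).trans ha
  · rw [← hm j]
    exact Finset.sum_congr rfl fun i _ => by rw [add_comm]; rfl
  · rw [smul_neg, ← hW j, ← Finset.sum_neg_distrib]
    exact Finset.sum_congr rfl fun i _ => by rw [← smul_neg, neg_sub]; rfl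

/-- The critical visibility of a qubit POVM and its antipodal POVM exists. -/
theorem exists_isCriticalVisibility_antipodal {a : X → ℝ} {u : X → EuclideanSpace ℝ (Fin 3)}
    (hu : ∑ i, u i = 0) {s₀ : ℝ} (hs₀ : s₀ ∈ Set.Icc (0 : ℝ) 1)
    (h : JointlyMeasurable (fun i => depolarise s₀ (blochOperator (a i) (u i)))
        (fun i => depolarise s₀ (antipodal (blochOperator (a i) (u i))))) :
    ∃ t, IsCriticalVisibility (fun i => blochOperator (a i) (u i))
      (fun i => antipodal (blochOperator (a i) (u i))) t ∧ s₀ ≤ t := by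
  suffices hcomp : IsCompact {s : ℝ | s ∈ Set.Icc (0 : ℝ) 1 ∧
      JointlyMeasurable (fun i => depolarise s (blochOperator (a i) (u i)))
        (fun i => depolarise s (antipodal (blochOperator (a i) (u i))))} by
    obtain ⟨t, ht⟩ := hcomp.exists_isGreatest ⟨s₀, hs₀, h⟩
    exact ⟨t, ht, ht.2 ⟨hs₀, h⟩⟩
  -- The feasible visibilities are the projection of a compact set of pairs (visibility, joint
  -- measurement), cut out by closed marginal conditions.
  have hclosed : IsClosed {r : ℝ × ((X × X → ℝ) × (X × X → EuclideanSpace ℝ (Fin 3))) |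
      (∀ i, ∑ j, r.2.1 (i, j) = a i) ∧ (∀ j, ∑ i, r.2.1 (i, j) = a j) ∧
        (∀ i, ∑ j, r.2.2 (i, j) = r.1 • u i) ∧ ∀ j, ∑ i, r.2.2 (i, j) = r.1 • -u j} := by
    simp only [Set.ofPred_and, Set.ofPred_forall]
    refine (isClosed_iInter fun i => ?_).inter ((isClosed_iInter fun i => ?_).inter
      ((isClosed_iInter fun i => ?_).inter (isClosed_iInter fun i => ?_))) <;>
    exact isClosed_eq (by fun_prop) (by fun_prop)
  have := (((isCompact_Icc (a := (0 : ℝ)) (b := 1)).prod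
    (isCompact_blochPOVMSet (X × X))).inter_right hclosed).image continuous_fst
  convert this using 1
  ext s
  simp only [jointlyMeasurable_depolarise_antipodal_iff hu, Set.mem_ofPred_eq, Set.mem_image,
    Set.mem_inter_iff, Set.mem_prod]
  constructor
  · rintro ⟨hs, q, hq, hr⟩
    exact ⟨(s, q), ⟨⟨hs, hq⟩, hr⟩, rfl⟩
  · rintro ⟨⟨_, q⟩, ⟨⟨hs, hq⟩, hr⟩, rfl⟩
    exact ⟨hs, q, hq, hr⟩

end Antipodal

/-! ### Upper bound for the tetrahedron -/

section Tetrahedron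

variable {v : Fin 4 → EuclideanSpace ℝ (Fin 3)}

theorem tetraPOVM_eq_blochOperator (v : Fin 4 → EuclideanSpace ℝ (Fin 3)) (i : Fin 4) :
    tetraPOVM v i = blochOperator (1 / 4) ((1 / 4 : ℝ) • v i) := by
  ext j k
  fin_cases j <;> fin_cases k <;> apply Complex.ext <;>
    simp [tetraPOVM, blochOperator, pauli, Fin.sum_univ_three] <;> ring

/-- Four vectors in dimension three satisfy a nontrivial linear relation. Equal mutual inner
products force its coefficients to be equal, so the vertices sum to zero; pairing that sum with one
vertex fixes the edge length. -/
theorem IsUnitRegularTetrahedron.sum_eq_zero_and_dist_sq (hv : IsUnitRegularTetrahedron v) :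
    ∑ i, v i = 0 ∧ ∀ i j, i ≠ j → ‖v i - v j‖ ^ 2 = 8 / 3 := by
  obtain ⟨h1, l, hl, hd⟩ := hv
  have hin : ∀ i j, i ≠ j → inner ℝ (v j) (v i) = 1 - l ^ 2 / 2 := by
    intro i j hij
    have h := norm_sub_sq_real (v j) (v i)
    rw [← dist_eq_norm, hd j i hij.symm, h1, h1] at h
    linarith
  have hself : ∀ i, inner ℝ (v i) (v i) = (1 : ℝ) := fun i => by
    rw [real_inner_self_eq_norm_sq, h1, one_pow]
  have hexp : ∀ (g : Fin 4 → ℝ) (j : Fin 4), inner ℝ (v j) (∑ i, g i • v i) =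
      (1 - l ^ 2 / 2) * ∑ i, g i + l ^ 2 / 2 * g j := by
    intro g j
    rw [inner_sum]
    have : ∀ i, inner ℝ (v j) (g i • v i) =
        (1 - l ^ 2 / 2) * g i + if i = j then l ^ 2 / 2 * g j else 0 := by
      intro i
      rw [real_inner_smul_right]
      by_cases hij : i = j
      · subst hij
        rw [hself, if_pos rfl]
        ring
      · rw [hin i j hij, if_neg hij]
        ring
    simp only [this, Finset.sum_add_distrib, ← Finset.mul_sum, Finset.sum_ite_eq',
      Finset.mem_univ, if_true]
  have hdep : ¬LinearIndependent ℝ v := fun h => by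
    have := h.fintype_card_le_finrank
    simp at this
  obtain ⟨g, hg, k, hk⟩ := Fintype.not_linearIndependent_iff.1 hdep
  have hconst : ∀ j, g j = g k := by
    intro j
    have hj := hexp g j
    have hk := hexp g k
    rw [hg, inner_zero_right] at hj hk
    have : l ^ 2 / 2 * g j = l ^ 2 / 2 * g k := by linarith
    exact mul_left_cancel₀ (by positivity) this
  have hsum : ∑ i, v i = 0 := by
    simp only [hconst, ← Finset.smul_sum] at hg
    exact (smul_eq_zero.1 hg).resolve_left hk
  refine ⟨hsum, fun i j hij => ?_⟩
  have h := hexp (fun _ => 1) 0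
  simp only [one_smul, hsum, inner_zero_right, Finset.sum_const, Finset.card_univ,
    Fintype.card_fin, nsmul_eq_mul, mul_one] at h
  rw [← dist_eq_norm, hd i j hij]
  push_cast at h
  linarith

/-- The edges `v i - v j` are a dual witness. The total pairing of `W (i, j)` with them is `2 * s`
by the marginals, and at most `√(8/3)` by Cauchy–Schwarz, as the weights sum to one. -/
theorem IsUnitRegularTetrahedron.le_sqrt_of_jointlyMeasurable (hv : IsUnitRegularTetrahedron v)
    {s : ℝ} (h : JointlyMeasurable (fun i => depolarise s (tetraPOVM v i))
      (fun i => depolarise s (antipodal (tetraPOVM v i)))) : s ≤ √(2 / 3) := by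
  obtain ⟨hsum, hdist⟩ := hv.sum_eq_zero_and_dist_sq
  simp only [tetraPOVM_eq_blochOperator] at h
  rw [jointlyMeasurable_depolarise_antipodal_iff (by rw [← Finset.smul_sum, hsum, smul_zero])] at h
  obtain ⟨⟨m, W⟩, ⟨h1, h2⟩, -, -, hl, hr⟩ := h
  simp only at h1 h2 hl hr
  have hnorm : ∀ i j, ‖v i - v j‖ ≤ √(8 / 3) := by
    intro i j
    by_cases hij : i = j
    · rw [hij, sub_self, norm_zero]
      exact Real.sqrt_nonneg _
    · exact Real.le_sqrt_of_sq_le (hdist i j hij).le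
  have hle : ∀ i j, inner ℝ (W (i, j)) (v i - v j) ≤ m (i, j) * √(8 / 3) := fun i j =>
    (real_inner_le_norm _ _).trans
      (mul_le_mul (h1 _) (hnorm i j) (norm_nonneg _) ((norm_nonneg _).trans (h1 _)))
  have hupper : ∑ i, ∑ j, inner ℝ (W (i, j)) (v i - v j) ≤ √(8 / 3) := by
    refine (Finset.sum_le_sum fun i _ => Finset.sum_le_sum fun j _ => hle i j).trans ?_
    simp only [← Finset.sum_mul]
    rw [← Fintype.sum_prod_type, h2, one_mul]
  have hval : ∑ i, ∑ j, inner ℝ (W (i, j)) (v i - v j) = 2 * s := by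
    simp only [inner_sub_right, Finset.sum_sub_distrib]
    rw [Finset.sum_comm (f := fun i j => inner ℝ (W (i, j)) (v j))]
    simp only [← sum_inner, hl, hr, real_inner_smul_left, inner_neg_left,
      real_inner_self_eq_norm_sq, hv.norm_eq_one]
    simp
    ring
  have h83 : √(8 / 3) = 2 * √(2 / 3) := by
    rw [show (8 / 3 : ℝ) = 2 ^ 2 * (2 / 3) by norm_num, Real.sqrt_mul (by norm_num),
      Real.sqrt_sq (by norm_num)]
  linarith

end Tetrahedron

theorem sqrt_two_thirds_mem_Icc : √(2 / 3) ∈ Set.Icc (0 : ℝ) 1 :=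
  ⟨Real.sqrt_nonneg _, Real.sqrt_le_one.2 (by norm_num)⟩

theorem corollary1 (v : Fin 4 → EuclideanSpace ℝ (Fin 3)) (hv : IsUnitRegularTetrahedron v) :
    IsPOVM (tetraPOVM v) ∧
    IsPOVM (fun i => antipodal (tetraPOVM v i)) ∧
    IsCriticalVisibility (tetraPOVM v) (fun i => antipodal (tetraPOVM v i)) (√(2 / 3)) ∧
    ∀ (n : ℕ) (A : Fin n → Matrix (Fin 2) (Fin 2) ℂ), IsPOVM A →
      IsPOVM (fun i => antipodal (A i)) ∧
      ∃ t : ℝ, IsCriticalVisibility A (fun i => antipodal (A i)) t ∧ √(2 / 3) ≤ t := by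
  have hpovm : IsPOVM (tetraPOVM v) := by
    have : tetraPOVM v = fun i => blochOperator (1 / 4) ((1 / 4 : ℝ) • v i) :=
      funext (tetraPOVM_eq_blochOperator v)
    rw [this, isPOVM_blochOperator_iff]
    refine ⟨fun i => ?_, by simp, ?_⟩
    · rw [norm_smul, hv.norm_eq_one]
      norm_num
    · rw [← Finset.smul_sum, hv.sum_eq_zero_and_dist_sq.1, smul_zero]
  have hall : ∀ (n : ℕ) (A : Fin n → Matrix (Fin 2) (Fin 2) ℂ), IsPOVM A →
      IsPOVM (fun i => antipodal (A i)) ∧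
      ∃ t : ℝ, IsCriticalVisibility A (fun i => antipodal (A i)) t ∧ √(2 / 3) ≤ t := by
    intro n A hA
    obtain ⟨a, u, rfl⟩ : ∃ (a : Fin n → ℝ) (u : Fin n → EuclideanSpace ℝ (Fin 3)),
        A = fun i => blochOperator (a i) (u i) :=
      ⟨_, _, funext fun i => (blochOperator_blochVector (hA.posSemidef i).isHermitian).symm⟩
    obtain ⟨hau, ha, hu⟩ := isPOVM_blochOperator_iff.1 hA
    refine ⟨?_, exists_isCriticalVisibility_antipodal hu sqrt_two_thirds_mem_Icc
      (jointlyMeasurable_depolarise_sqrt hau ha hu)⟩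
    simp only [antipodal_blochOperator]
    exact isPOVM_blochOperator_iff.2
      ⟨by simpa using hau, ha, by rw [Finset.sum_neg_distrib, hu, neg_zero]⟩
  -- The general lower bound, applied to the tetrahedron itself, shows that the upper bound is
  -- attained.
  obtain ⟨hanti, t, ht, hle⟩ := hall 4 (tetraPOVM v) hpovm
  have hteq : t = √(2 / 3) := (hv.le_sqrt_of_jointlyMeasurable ht.1.2).antisymm hle
  exact ⟨hpovm, hanti, hteq ▸ ht, hall⟩
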